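/- **Setting.** Let $\mathcal S=\{1,\dots,S\}$, $\Delta^S=\{p\in\mathbb R^S: p\ge 0,\ \sum_k p_k=1\}$, $z\in\mathbb R^S$, $\bar p\in\Delta^S$, and let $w\in\mathbb R^S$ have strictly positive entries. Put $\|x\|_{1,w}=\sum_k w_k|x_k|$ and, for $\xi\in[0,\infty]$, $$q(\xi)=\min\{p^\top z : p\in\Delta^S,\ \|p-\bar p\|_{1,w}\le \xi\},$$ where the norm constraint is void for $\xi=\infty$. For finite $\xi$ this is also the value of the linear program in $(p,l)$: minimize $z^\top p$ subject to $p-\bar p\le l$, $\bar p-p\le l$, $p\ge0$, $\mathbf 1^\top p=1$, $w^\top l=\xi$. For a basis of this program ($2S$ linearly independent constraints taken as equalities), let $\mathcal U$ (resp. $\mathcal L$) be the set of indices $k$ for which, among $p_k-\bar p_k\le l_k$, $\bar p_k-p_k\le l_k$, $p_k\ge 0$, exactly the first (resp. exactly the second) belongs to the basis. **Homotopy algorithm.** For $i\ne j$ let $\alpha_{ij}=(z_i-z_j)/(w_i+w_j)$ and, if $w_i\ne w_j$, $\beta_{ij}=(z_i-z_j)/(w_i-w_j)$. Let $d_1,\dots,d_T$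 be a list of all $(\alpha_{ij},\mathrm{C1})$ with $i\neq j$, $\alpha_{ij}<0$ and all $(\beta_{ij},\mathrm{C2})$ with $i\neq j$, $w_i\ne w_j$, $\beta_{ij}<0$, one entry for each ordered pair $(i,j)$ and case, sorted in ascending order of the first component (the slope). The entry $(\alpha_{ij},\mathrm{C1})$ represents bases with $\mathcal U=\{i\}$, $\mathcal L=\{j\}$, and $(\beta_{ij},\mathrm{C2})$ bases with $\mathcal U=\{i,j\}$, $\mathcal L=\emptyset$. Start with $\xi_0=0$, $p_0=\bar p$, $q_0=\bar p^\top z$. For $l=1,\dots,T$: if there is no basis of the linear program with the sets $\mathcal U,\mathcal L$ of $d_l$ whose basic solution for $\xi=\xi_{l-1}$ is feasible and has $p$-part $p_{l-1}$, put $(\xi_l,p_l,q_l)=(\xi_{l-1},p_{l-1},q_{l-1})$. Otherwise let $\dot q$ be the slope of $d_l$, let $\dot p$ have $\dot p_i=-\dot p_j=1/(w_i+w_j)$ in case C1 and $\dot p_i=-\dot p_j=1/(w_i-w_j)$ in case C2, with all other components $0$, and put $(\xi_l,p_l,q_l)=(\xi_{l-1}+\delta,\ p_{l-1}+\delta\dot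 p,\ q_{l-1}+\delta\dot q)$, where $\delta$ is the largest $\delta\ge0$ with $(p_{l-1})_j+\delta\dot p_j\ge 0$ in case C1, with $(p_{l-1})_j+\delta\dot p_j\ge\bar p_j$ in case C2 with $w_i>w_j$, and with $(p_{l-1})_i+\delta\dot p_i\ge\bar p_i$ in case C2 with $w_i<w_j$. Finally put $\xi_{T+1}=\infty$ and $q_{T+1}=q_T$, and output $(\xi_t)_{t=0}^{T+1}$ and $(q_t)_{t=0}^{T+1}$. **Theorem.** Assume that entries of the list with different pairs $(\mathcal U,\mathcal L)$ have different slopes. Let $(\xi_t)_{t=0}^{T+1}$ and $(q_t)_{t=0}^{T+1}$ be the output of the homotopy algorithm, for any admissible sorting of the list. Then the minimum defining $q(\xi)$ is attained for every $\xi\in[0,\infty]$; $0=\xi_0\le\xi_1\le\dots\le\xi_T<\xi_{T+1}=\infty$; and $q$ is a piecewise affine function with exactly these breakpoints: it is affine on $[\xi_t,\xi_{t+1}]$ for $t=0,\dots,T-1$, it is constant and equal to $q_{T+1}$ on $[\xi_T,\infty)$, and a point $\xi\in(0,\infty)$ equals one of the $\xi_t$ if and only if $q$ is not affine on any neighborhood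 of $\xi$. Moreover $q(\xi_t)=q_t$ for $t=0,\dots,T+1$. -/

import Mathlib

open scoped BigOperators

/-- The weighted `L₁`-norm `‖x‖_{1,w} = ∑ i, w i * |x i|`. -/
def wnorm {S : ℕ} (w x : Fin S → ℝ) : ℝ := ∑ i, w i * |x i|

/-- The objective values `pᵀ z` of the distributions `p` with `‖p - pbar‖_{1,w} ≤ ξ`.
The radius may be `∞ = ⊤`, in which case the norm constraint is void. -/
def feasibleValues {S : ℕ} (z w pbar : Fin S → ℝ) (ξ : EReal) : Set ℝ :=
  {v | ∃ p ∈ stdSimplex ℝ (Fin S), ((wnorm w (p - pbar) : ℝ) : EReal) ≤ ξ ∧ v = p ⬝ᵥ z}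

/-- The parametric worst-case value
`q(ξ) = min {pᵀ z : p ∈ Δ, ‖p - pbar‖_{1,w} ≤ ξ}`. -/
noncomputable def worstCase {S : ℕ} (z w pbar : Fin S → ℝ) (ξ : EReal) : ℝ :=
  sInf (feasibleValues z w pbar ξ)

/-- `f` has a breakpoint at `x`: on no neighbourhood of `x` is it affine. -/
def HasBreakpointAt (f : EReal → ℝ) (x : ℝ) : Prop :=
  ¬ ∃ a b : ℝ, ∀ᶠ y in nhds x, f (y : EReal) = a + b * y

namespace Homotopy

/-! ### Bases of the linear program

minimize `zᵀ p` over `p, l` subject to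
`p - pbar ≤ l`, `pbar - p ≤ l`, `p ≥ 0`, `1ᵀ p = 1`, `wᵀ l = ξ`. -/

/-- Feasibility of `(p, l)` in the linear program with parameter `ξ`. -/
def LPFeasible {S : ℕ} (w pbar : Fin S → ℝ) (ξ : ℝ) (p l : Fin S → ℝ) : Prop :=
  (∀ k, p k - pbar k ≤ l k) ∧ (∀ k, pbar k - p k ≤ l k) ∧ (∀ k, 0 ≤ p k) ∧
    ∑ k, p k = 1 ∧ ∑ k, w k * l k = ξ

/-- The possible sets of constraints of one component `k`, among
`p k - pbar k ≤ l k`, `pbar k - p k ≤ l k` and `p k ≥ 0`, that belong to a basis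
(at most two of them): none, the first, the second, the first two; and
none, the first, the second, each together with `p k ≥ 0`. -/
inductive Status
  | N | U | L | E | Nbar | Ubar | Lbar

/-- The equations that a status imposes on `pbar k`, `p k`, `l k`. -/
def Status.Active (c : Status) (pbar p l : ℝ) : Prop :=
  match c with
  | .N => True
  | .U => p - pbar = l
  | .L => pbar - p = l
  | .E => p - pbar = l ∧ pbar - p = l
  | .Nbar => p = 0
  | .Ubar => p - pbar = l ∧ p = 0
  | .Lbar => pbar - p = l ∧ p = 0

/-- The number of constraints of a component that belong to the basis. -/
def Status.count (c : Status) : ℕ :=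
  match c with
  | .N => 0
  | .U => 1
  | .L => 1
  | .E => 2
  | .Nbar => 1
  | .Ubar => 2
  | .Lbar => 2

/-- The two cases of bases that the algorithm considers, for an ordered pair `(i, j)`:
`C1 i j` stands for `𝒰 = {i}`, `ℒ = {j}` and `C2 i j` for `𝒰 = {i, j}`, `ℒ = ∅`. -/
inductive Entry (S : ℕ)
  | C1 (i j : Fin S)
  | C2 (i j : Fin S)

namespace Entry

variable {S : ℕ}

/-- The basis of an entry, as the pair `(𝒰, ℒ)`.
(`C2 i j` and `C2 j i` have the same basis.) -/
def basis (d : Entry S) : Finset (Fin S) × Finset (Fin S) :=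
  match d with
  | C1 i j => ({i}, {j})
  | C2 i j => ({i, j}, ∅)

/-- The slope `α i j` or `β i j` of an entry; this is the derivative of `q` along the basis. -/
noncomputable def slope (z w : Fin S → ℝ) (d : Entry S) : ℝ :=
  match d with
  | C1 i j => (z i - z j) / (w i + w j)
  | C2 i j => (z i - z j) / (w i - w j)

/-- The derivative of `p` along the basis. -/
noncomputable def pdot (w : Fin S → ℝ) (d : Entry S) : Fin S → ℝ :=
  match d with
  | C1 i j => Pi.single i (1 / (w i + w j)) - Pi.single j (1 / (w i + w j))
  | C2 i j => Pi.single i (1 / (w i - w j)) - Pi.single j (1 / (w i - w j))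

/-- The entries that the algorithm stores in its list. -/
def IsStored (z w : Fin S → ℝ) (d : Entry S) : Prop :=
  match d with
  | C1 i j => i ≠ j ∧ slope z w (C1 i j) < 0
  | C2 i j => i ≠ j ∧ w i ≠ w j ∧ slope z w (C2 i j) < 0

/-- The basis of the entry is feasible for `ξ` at the current point `p`: there is a basis of the
linear program with the prescribed sets `𝒰` and `ℒ` whose basic solution for `ξ` is `p` (with
some `l`) and is feasible. A basis has `2 * S` linearly independent constraints; since both
equality constraints belong to it here, `2 * S - 2` come from the components, and the
linear independence is then automatic (as `w > 0`, and as `w i ≠ w j` for stored `C2 i j`). -/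
def Feasible (w pbar : Fin S → ℝ) (ξ : ℝ) (p : Fin S → ℝ) (d : Entry S) : Prop :=
  ∃ (B : Fin S → Status) (l : Fin S → ℝ),
    (∀ k, B k = Status.U ↔ k ∈ d.basis.1) ∧ (∀ k, B k = Status.L ↔ k ∈ d.basis.2) ∧
    (∑ k, (B k).count) + 2 = 2 * S ∧
    LPFeasible w pbar ξ p l ∧ ∀ k, (B k).Active (pbar k) (p k) (l k)

open Classical in
/-- The set of step sizes `Δ ≥ 0` for which the donor stays within its bound. The step size is
the maximum of this set. -/
noncomputable def steps (w pbar p : Fin S → ℝ) (d : Entry S) : Set ℝ :=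
  match d with
  | C1 i j => {Δ | 0 ≤ Δ ∧ 0 ≤ p j + Δ * pdot w (C1 i j) j}
  | C2 i j =>
      if w i > w j then {Δ | 0 ≤ Δ ∧ pbar j ≤ p j + Δ * pdot w (C2 i j) j}
      else {Δ | 0 ≤ Δ ∧ pbar i ≤ p i + Δ * pdot w (C2 i j) i}

end Entry

/-- The variables `ξ_l`, `p_l`, `q_l` of the algorithm. -/
structure State (S : ℕ) where
  ξ : ℝ
  p : Fin S → ℝ
  q : ℝ

/-- Initialization. -/
noncomputable def initial {S : ℕ} (z pbar : Fin S → ℝ) : State S :=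
  ⟨0, pbar, pbar ⬝ᵥ z⟩

open Classical in
/-- One iteration of the tracing loop. -/
noncomputable def step {S : ℕ} (z w pbar : Fin S → ℝ) (s : State S) (d : Entry S) : State S :=
  if d.Feasible w pbar s.ξ s.p then
    let Δ := sSup (d.steps w pbar s.p)
    ⟨s.ξ + Δ, s.p + Δ • d.pdot w, s.q + Δ * d.slope z w⟩
  else s

/-- The state `(ξ_t, p_t, q_t)` after `t` iterations of the loop over the list `D`. -/
noncomputable def trace {S : ℕ} (z w pbar : Fin S → ℝ) (D : List (Entry S)) (t : ℕ) : State S :=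
  (D.take t).foldl (step z w pbar) (initial z pbar)

/-- The output `ξ_0, …, ξ_T, ξ_{T+1} = ∞`, where `T` is the length of `D`. -/
noncomputable def outXi {S : ℕ} (z w pbar : Fin S → ℝ) (D : List (Entry S))
    (t : Fin (D.length + 2)) : EReal :=
  if (t : ℕ) ≤ D.length then ((trace z w pbar D t).ξ : EReal) else ⊤

/-- The output `q_0, …, q_T, q_{T+1} = q_T`. -/
noncomputable def outQ {S : ℕ} (z w pbar : Fin S → ℝ) (D : List (Entry S))
    (t : Fin (D.length + 2)) : ℝ :=
  if (t : ℕ) ≤ D.length then (trace z w pbar D t).q else (trace z w pbar D D.length).q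

/-- `D` is a list of all stored entries, each once, in ascending order of the slopes. -/
def IsSortedList {S : ℕ} (z w : Fin S → ℝ) (D : List (Entry S)) : Prop :=
  D.Nodup ∧ (∀ d, d ∈ D ↔ d.IsStored z w) ∧ D.Pairwise (fun d e => d.slope z w ≤ e.slope z w)

/-- Every input has such a list. -/
theorem exists_isSortedList {S : ℕ} (z w : Fin S → ℝ) : ∃ D, IsSortedList z w D := by
  classical
  have hfin : {d : Entry S | d.IsStored z w}.Finite := by
    refine Set.Finite.subset (Set.finite_range (fun x : Bool × Fin S × Fin S =>
      if x.1 then Entry.C1 x.2.1 x.2.2 else Entry.C2 x.2.1 x.2.2)) ?_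
    rintro (⟨i, j⟩ | ⟨i, j⟩) _
    · exact ⟨(true, i, j), by simp⟩
    · exact ⟨(false, i, j), by simp⟩
  let le : Entry S → Entry S → Bool := fun d e => decide (d.slope z w ≤ e.slope z w)
  refine ⟨hfin.toFinset.toList.mergeSort le, ?_, ?_, ?_⟩
  · exact (List.mergeSort_perm _ le).nodup_iff.2 (Finset.nodup_toList _)
  · intro d
    simp
  · have h := List.pairwise_mergeSort (le := le)
      (fun a b c hab hbc => by simp only [le, decide_eq_true_eq] at *; exact hab.trans hbc)
      (fun a b => by simpa [le] using le_total _ _) hfin.toFinset.toList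
    exact h.imp (fun hab => by simpa [le] using hab)

/-- Different bases that the algorithm considers have different slopes. -/
def DistinctSlopes {S : ℕ} (z w : Fin S → ℝ) : Prop :=
  ∀ d e : Entry S, d.IsStored z w → e.IsStored z w → d.basis ≠ e.basis →
    d.slope z w ≠ e.slope z w

end Homotopy

/-! ### The parametric problem -/

/-! The proof is Lagrangian duality: price the norm constraint by `μ ≥ 0` and let `μ` decrease to
`0`. If `p` and `p'` both minimize `pᵀ z + μ ‖p - pbar‖_{1,w}` over the simplex, then `q` is affine
with slope `-μ` between their two distances from `pbar` (`IsLagrangeMin.worstCase_eq`); a minimizer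
for `μ = 0` gives the final constant piece.

Minimizers are recognized by complementary slackness, `IsDualOptimal`. Raising `p k` above nominal
costs `z k + μ * w k` per unit of mass; mass removed below nominal saves `z k - μ * w k`. As `μ`
decreases, the comparison of two such costs changes only at a tie, and the slope of an entry is
minus the multiplier of its tie. Hence scanning slopes in ascending order scans all critical
multipliers.

The loop invariant `TraceInvariant` says that all entries passed so far are exhausted, and that the
current point is dual optimal for every multiplier between the last slope passed and the next one.
At a new entry, exhaustion makes the step trivial. Otherwise the entry ties at a dual optimal point,
distinct slopes exclude unrelated ties, so the basis is feasible and the step transfers mass until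
the entry is exhausted. Such a transfer preserves dual optimality and earlier exhaustion. Both ends
of the step thus minimize the same Lagrangian. Two steps of positive length have different bases,
hence different slopes, so the kinks are genuine. -/

theorem isLeast_worstCase {S : ℕ} {z w pbar : Fin S → ℝ} (hpbar : pbar ∈ stdSimplex ℝ (Fin S))
    {x : EReal} (hx : 0 ≤ x) :
    IsLeast (feasibleValues z w pbar x) (worstCase z w pbar x) := by
  have hcont : Continuous fun p : Fin S → ℝ => ((wnorm w (p - pbar) : ℝ) : EReal) := by
    refine continuous_coe_real_ereal.comp ?_
    unfold wnorm
    fun_prop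
  have hcompact : IsCompact (stdSimplex ℝ (Fin S) ∩
      {p | ((wnorm w (p - pbar) : ℝ) : EReal) ≤ x}) :=
    (isCompact_stdSimplex ℝ (Fin S)).inter_right (isClosed_le hcont continuous_const)
  have himage : feasibleValues z w pbar x = (fun p : Fin S → ℝ => p ⬝ᵥ z) ''
      (stdSimplex ℝ (Fin S) ∩ {p | ((wnorm w (p - pbar) : ℝ) : EReal) ≤ x}) := by
    ext v
    simp only [feasibleValues, Set.mem_ofPred_eq, Set.mem_image, Set.mem_inter_iff]
    constructor
    · rintro ⟨p, hp, hn, rfl⟩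
      exact ⟨p, ⟨hp, hn⟩, rfl⟩
    · rintro ⟨p, ⟨hp, hn⟩, rfl⟩
      exact ⟨p, hp, hn, rfl⟩
  have hdot : Continuous fun p : Fin S → ℝ => p ⬝ᵥ z := by
    unfold dotProduct
    fun_prop
  unfold worstCase
  rw [himage]
  refine (hcompact.image hdot).isLeast_sInf ⟨_, pbar, ⟨hpbar, ?_⟩, rfl⟩
  simpa [wnorm] using hx

theorem wnorm_nonneg {S : ℕ} {w : Fin S → ℝ} (hw : ∀ k, 0 < w k) (x : Fin S → ℝ) :
    0 ≤ wnorm w x :=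
  Finset.sum_nonneg fun k _ => mul_nonneg (hw k).le (abs_nonneg _)

theorem worstCase_le {S : ℕ} {z w pbar p : Fin S → ℝ} (hpbar : pbar ∈ stdSimplex ℝ (Fin S))
    (hw : ∀ k, 0 < w k) (hp : p ∈ stdSimplex ℝ (Fin S)) {x : EReal}
    (hx : ((wnorm w (p - pbar) : ℝ) : EReal) ≤ x) : worstCase z w pbar x ≤ p ⬝ᵥ z :=
  (isLeast_worstCase hpbar
    ((EReal.coe_nonneg.2 (wnorm_nonneg hw (p - pbar))).trans hx)).2 ⟨p, hp, hx, rfl⟩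

theorem wnorm_convex_comb_le {S : ℕ} {w pbar p p' : Fin S → ℝ} (hw : ∀ k, 0 < w k) {a b : ℝ}
    (ha : 0 ≤ a) (hb : 0 ≤ b) (hab : a + b = 1) :
    wnorm w (a • p + b • p' - pbar) ≤ a * wnorm w (p - pbar) + b * wnorm w (p' - pbar) := by
  unfold wnorm
  rw [Finset.mul_sum, Finset.mul_sum, ← Finset.sum_add_distrib]
  refine Finset.sum_le_sum fun k _ => ?_
  have h : (a • p + b • p' - pbar) k = a * (p - pbar) k + b * (p' - pbar) k := by
    simp only [Pi.sub_apply, Pi.add_apply, Pi.smul_apply, smul_eq_mul]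
    linear_combination (pbar k) * hab
  rw [h]
  have h1 := abs_add_le (a * (p - pbar) k) (b * (p' - pbar) k)
  rw [abs_mul, abs_mul, abs_of_nonneg ha, abs_of_nonneg hb] at h1
  nlinarith [mul_le_mul_of_nonneg_left h1 (hw k).le]

/-- `p` minimizes the Lagrangian `pᵀ z + μ ‖p - pbar‖_{1,w}` over the simplex. -/
def IsLagrangeMin {S : ℕ} (z w pbar : Fin S → ℝ) (μ : ℝ) (p : Fin S → ℝ) : Prop :=
  ∀ p' ∈ stdSimplex ℝ (Fin S),
    p ⬝ᵥ z + μ * wnorm w (p - pbar) ≤ p' ⬝ᵥ z + μ * wnorm w (p' - pbar)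

/-- Weak duality: for a minimizer of radius `x`, replacing its norm by `x` in the Lagrangian only
increases the value, as `μ ≥ 0`. -/
theorem IsLagrangeMin.le_worstCase {S : ℕ} {z w pbar p : Fin S → ℝ} {μ x : ℝ}
    (h : IsLagrangeMin z w pbar μ p) (hpbar : pbar ∈ stdSimplex ℝ (Fin S)) (hμ : 0 ≤ μ)
    (hx : 0 ≤ x) :
    p ⬝ᵥ z + μ * (wnorm w (p - pbar) - x) ≤ worstCase z w pbar x := by
  obtain ⟨p', hp', hn, hv⟩ := (isLeast_worstCase (z := z) (w := w) hpbar
    (EReal.coe_nonneg.2 hx)).1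
  rw [hv]
  have := h p' hp'
  have := mul_le_mul_of_nonneg_left (EReal.coe_le_coe_iff.1 hn) hμ
  linarith

/-- With `μ = 0` the norm drops out and `p` is optimal on the whole simplex, so every radius that
admits `p`, including `⊤`, has the same value. -/
theorem IsLagrangeMin.worstCase_top {S : ℕ} {z w pbar p : Fin S → ℝ}
    (h : IsLagrangeMin z w pbar 0 p) (hpbar : pbar ∈ stdSimplex ℝ (Fin S))
    (hw : ∀ k, 0 < w k) (hp : p ∈ stdSimplex ℝ (Fin S)) {x : EReal}
    (hx : ((wnorm w (p - pbar) : ℝ) : EReal) ≤ x) : worstCase z w pbar x = p ⬝ᵥ z := by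
  refine (worstCase_le hpbar hw hp hx).antisymm ?_
  obtain ⟨p', hp', hn, hv⟩ := (isLeast_worstCase (z := z) (w := w) hpbar
    ((EReal.coe_nonneg.2 (wnorm_nonneg hw (p - pbar))).trans hx)).1
  rw [hv]
  simpa using h p' hp'

/-- Between two minimizers of the same Lagrangian, `q` is affine. -/
theorem IsLagrangeMin.worstCase_eq {S : ℕ} {z w pbar p p' : Fin S → ℝ} {μ x : ℝ}
    (h : IsLagrangeMin z w pbar μ p) (h' : IsLagrangeMin z w pbar μ p')
    (hpbar : pbar ∈ stdSimplex ℝ (Fin S)) (hw : ∀ k, 0 < w k) (hμ : 0 ≤ μ)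
    (hp : p ∈ stdSimplex ℝ (Fin S)) (hp' : p' ∈ stdSimplex ℝ (Fin S))
    (hx : wnorm w (p - pbar) ≤ x) (hx' : x ≤ wnorm w (p' - pbar)) :
    worstCase z w pbar x = (p ⬝ᵥ z + μ * wnorm w (p - pbar)) + (-μ) * x := by
  have hlow := h.le_worstCase hpbar hμ ((wnorm_nonneg hw _).trans hx)
  refine le_antisymm ?_ (by linarith)
  -- Equal Lagrangian values put both endpoints on the line of slope `-μ`. By convexity of the norm,
  -- the convex combination with weights taken from `x` is feasible for `x`, and its objective
  -- attains the weak duality bound.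
  have heq := (h p' hp').antisymm (h' p hp)
  have hseg : x ∈ segment ℝ (wnorm w (p - pbar)) (wnorm w (p' - pbar)) := by
    rw [segment_eq_Icc (hx.trans hx')]
    exact ⟨hx, hx'⟩
  obtain ⟨a, b, ha, hb, hab, hcomb⟩ := hseg
  simp only [smul_eq_mul] at hcomb
  have hle := worstCase_le (z := z) (x := (x : EReal)) hpbar hw
    (convex_stdSimplex ℝ (Fin S) hp hp' ha hb hab)
    (EReal.coe_le_coe_iff.2 ((wnorm_convex_comb_le hw ha hb hab).trans_eq hcomb))
  rw [add_dotProduct, smul_dotProduct, smul_dotProduct, smul_eq_mul, smul_eq_mul] at hle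
  refine hle.trans_eq ?_
  rw [← hcomb]
  obtain rfl : a = 1 - b := by linarith
  linear_combination (-b) * heq

/-! ### Complementary slackness -/

namespace Homotopy

/-- At the multiplier `μ`, the component `a` is a cheapest receiver of mass. -/
def IsReceiver {S : ℕ} (z w : Fin S → ℝ) (μ : ℝ) (a : Fin S) : Prop :=
  ∀ k, z a + μ * w a ≤ z k + μ * w k

/-- The complementary slackness conditions for the Lagrangian with multiplier `μ`. -/
structure IsDualOptimal {S : ℕ} (z w pbar : Fin S → ℝ) (μ : ℝ) (p : Fin S → ℝ) : Prop where
  receiver : ∀ k, pbar k < p k → IsReceiver z w μ k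
  donor : ∀ k, p k < pbar k → ∃ j, z j + μ * w j ≤ z k - μ * w k
  keep : ∀ k, 0 < p k → ∀ j, z k - μ * w k ≤ z j + μ * w j

/-- The multiplier of `∑ k, p k = 1` is the cheapest receiving cost `m = z r + μ * w r`. After
subtracting `m * ∑ k, p k` the Lagrangian separates, and the slackness conditions make each `p k`
minimize its convex one-variable term on `[0, ∞)`. -/
theorem IsDualOptimal.isLagrangeMin {S : ℕ} {z w pbar p : Fin S → ℝ} {μ : ℝ}
    (h : IsDualOptimal z w pbar μ p) (hw : ∀ k, 0 < w k) (hμ : 0 ≤ μ)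
    (hp : p ∈ stdSimplex ℝ (Fin S)) : IsLagrangeMin z w pbar μ p := by
  intro p' hp'
  have hne : Nonempty (Fin S) := by
    by_contra hempty
    rw [not_nonempty_iff] at hempty
    simpa using hp.2
  obtain ⟨r, hr⟩ := Finite.exists_min fun k => z k + μ * w k
  have hsum : ∑ k, (z r + μ * w r) * (p' k - p k) = 0 := by
    rw [← Finset.mul_sum, Finset.sum_sub_distrib, hp.2, hp'.2]
    ring
  -- The subgradient inequality of one component; the linear corrections cancel in the sum because
  -- both points have total mass one.
  have hterm : ∀ k, (p k * z k + μ * (w k * |p k - pbar k|)) +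
      (z r + μ * w r) * (p' k - p k) ≤ p' k * z k + μ * (w k * |p' k - pbar k|) := by
    intro k
    have hpk := hp.1 k
    have hpk' := hp'.1 k
    have hμk : (z r + μ * w r) ≤ z k + μ * w k := hr k
    have hd : p k < pbar k → z r + μ * w r ≤ z k - μ * w k := fun hk => by
      obtain ⟨j, hj⟩ := h.donor k hk
      exact (hr j).trans hj
    have hk' : 0 < p k → z k - μ * w k ≤ z r + μ * w r := fun hk => h.keep k hk r
    have hrec : pbar k < p k → z k + μ * w k ≤ z r + μ * w r := fun hk => h.receiver k hk r
    have hc : 0 ≤ μ * w k := mul_nonneg hμ (hw k).le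
    rw [← mul_assoc, ← mul_assoc]
    generalize z r + μ * w r = m at *
    generalize μ * w k = c at *
    have h1 := mul_le_mul_of_nonneg_left (le_abs_self (p' k - pbar k)) hc
    have h2 := mul_le_mul_of_nonneg_left (neg_abs_le (p' k - pbar k)) hc
    rcases lt_trichotomy (p k) (pbar k) with hlt | heq | hgt
    · rw [abs_of_neg (sub_neg.2 hlt)]
      have h3 : 0 ≤ (z k - c - m) * (p' k - p k) := by
        rcases hpk.lt_or_eq with h0 | h0
        · rw [(hk' h0).antisymm (hd hlt), sub_self, zero_mul]
        · exact mul_nonneg (sub_nonneg.2 (hd hlt)) (by linarith)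
      linarith
    · rw [heq, sub_self, abs_zero]
      rcases le_or_gt (pbar k) (p' k) with hge | hlt
      · have h3 := mul_nonneg (sub_nonneg.2 hμk) (sub_nonneg.2 hge)
        linarith
      · have h3 := mul_nonneg (sub_nonneg.2 (hk' (by linarith))) (sub_nonneg.2 hlt.le)
        linarith
    · rw [abs_of_pos (sub_pos.2 hgt)]
      have h3 : m = z k + c := hμk.antisymm (hrec hgt)
      rw [h3]
      linarith
  have := Finset.sum_le_sum fun k (_ : k ∈ Finset.univ) => hterm k
  rw [Finset.sum_add_distrib, hsum, add_zero, Finset.sum_add_distrib, Finset.sum_add_distrib,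
    ← Finset.mul_sum, ← Finset.mul_sum] at this
  exact this

end Homotopy


namespace Homotopy

/-! ### Stored entries and tied components -/

/-- The cost difference `(z i - z j) + μ * (w i + w j)` increases in `μ` and vanishes at minus the
slope, so a negative difference means that the tie lies at a larger multiplier. The next three
lemmas are the analogues for exact ties and for `C2`. -/
theorem isStored_C1_of_lt {S : ℕ} {z w : Fin S → ℝ} (hw : ∀ k, 0 < w k) {μ : ℝ} (hμ : 0 ≤ μ)
    {i j : Fin S} (h : z i + μ * w i < z j - μ * w j) :
    (Entry.C1 i j).IsStored z w ∧ (Entry.C1 i j).slope z w < -μ := by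
  have hpos := add_pos (hw i) (hw j)
  have hslope : (Entry.C1 i j).slope z w < -μ := by
    rw [Entry.slope, div_lt_iff₀ hpos]
    linarith
  refine ⟨⟨?_, by linarith⟩, hslope⟩
  rintro rfl
  nlinarith [mul_nonneg hμ (hw i).le]

theorem isStored_C1_of_eq {S : ℕ} {z w : Fin S → ℝ} (hw : ∀ k, 0 < w k) {μ : ℝ} (hμ : 0 < μ)
    {i j : Fin S} (h : z i + μ * w i = z j - μ * w j) :
    (Entry.C1 i j).IsStored z w ∧ (Entry.C1 i j).slope z w = -μ := by
  have hpos := add_pos (hw i) (hw j)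
  have hslope : (Entry.C1 i j).slope z w = -μ := by
    rw [Entry.slope, div_eq_iff hpos.ne']
    linarith
  refine ⟨⟨?_, by linarith⟩, hslope⟩
  rintro rfl
  nlinarith [mul_pos hμ (hw i)]

theorem isStored_C2_of_lt {S : ℕ} {z w : Fin S → ℝ} {μ : ℝ} (hμ : 0 ≤ μ)
    {i j : Fin S} (hij : w j < w i) (h : z i + μ * w i < z j + μ * w j) :
    (Entry.C2 i j).IsStored z w ∧ (Entry.C2 i j).slope z w < -μ := by
  have hslope : (Entry.C2 i j).slope z w < -μ := by
    rw [Entry.slope, div_lt_iff₀ (sub_pos.2 hij)]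
    linarith
  exact ⟨⟨fun h => hij.ne (h ▸ rfl), hij.ne', by linarith⟩, hslope⟩

theorem isStored_C2_of_eq {S : ℕ} {z w : Fin S → ℝ} {μ : ℝ} (hμ : 0 < μ)
    {i j : Fin S} (hij : w i ≠ w j) (h : z i + μ * w i = z j + μ * w j) :
    (Entry.C2 i j).IsStored z w ∧ (Entry.C2 i j).slope z w = -μ := by
  have hslope : (Entry.C2 i j).slope z w = -μ := by
    rw [Entry.slope, div_eq_iff (sub_ne_zero.2 hij)]
    linarith
  exact ⟨⟨fun h => hij (h ▸ rfl), hij, by linarith⟩, hslope⟩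

theorem Entry.IsStored.slope_neg {S : ℕ} {z w : Fin S → ℝ} {d : Entry S}
    (h : d.IsStored z w) : d.slope z w < 0 := by
  cases d with
  | C1 i j => exact h.2
  | C2 i j => exact h.2.2

theorem slope_C1_tie {S : ℕ} {z w : Fin S → ℝ} (hw : ∀ k, 0 < w k) (i j : Fin S) :
    z i - (Entry.C1 i j).slope z w * w i = z j + (Entry.C1 i j).slope z w * w j := by
  have h := div_mul_cancel₀ (z i - z j) (add_pos (hw i) (hw j)).ne'
  rw [Entry.slope]
  linarith

theorem slope_C2_tie {S : ℕ} {z w : Fin S → ℝ} {i j : Fin S} (hij : w i ≠ w j) :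
    z i - (Entry.C2 i j).slope z w * w i = z j - (Entry.C2 i j).slope z w * w j := by
  have h := div_mul_cancel₀ (z i - z j) (sub_ne_zero.2 hij)
  rw [Entry.slope]
  linarith

/-- No more mass can be moved along the basis of the entry. -/
def Exhausted {S : ℕ} (w pbar p : Fin S → ℝ) : Entry S → Prop
  | .C1 _ j => p j = 0
  | .C2 i j => (w j < w i → p j ≤ pbar j) ∧ (w i < w j → p i ≤ pbar i)

/-- Only `C2 i j` and `C2 j i` share a basis, and exhaustion is symmetric in them. Such entries have
equal slopes, so at most one of the two can move mass. -/
theorem exhausted_of_basis_eq {S : ℕ} {w pbar p : Fin S → ℝ} {d e : Entry S}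
    (h : d.basis = e.basis) (hd : Exhausted w pbar p d) : Exhausted w pbar p e := by
  cases d with
  | C1 i j =>
    cases e with
    | C1 i' j' =>
      simp only [Entry.basis, Prod.mk.injEq, Finset.singleton_inj] at h
      obtain ⟨rfl, rfl⟩ := h
      exact hd
    | C2 i' j' => simp [Entry.basis] at h
  | C2 i j =>
    cases e with
    | C1 i' j' => simp [Entry.basis] at h
    | C2 i' j' =>
      simp only [Entry.basis, Prod.mk.injEq, and_true] at h
      rw [← Finset.coe_inj] at h
      push_cast at h
      rcases Set.pair_eq_pair_iff.1 h with ⟨rfl, rfl⟩ | ⟨rfl, rfl⟩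
      · exact hd
      · exact ⟨hd.2, hd.1⟩

/-- Decreasing the multiplier preserves dual optimality as long as all entries that are passed
are exhausted. -/
theorem isDualOptimal_of_le {S : ℕ} {z w pbar p : Fin S → ℝ} (hw : ∀ k, 0 < w k) {μ ν : ℝ}
    (hrec : ∀ k, pbar k < p k → IsReceiver z w μ k)
    (hdon : ∀ k, p k < pbar k → ∃ j, z j + μ * w j ≤ z k - μ * w k)
    (hν : 0 ≤ ν) (hνμ : ν ≤ μ)
    (hex : ∀ e : Entry S, e.IsStored z w → e.slope z w < -ν → Exhausted w pbar p e) :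
    IsDualOptimal z w pbar ν p where
  receiver k hk j := by
    by_contra! hlt
    have h1 := hrec k hk j
    -- Lowering the multiplier makes `j` cheaper relative to `k` only if `j` is heavier. The entry
    -- `C2 j k` has then been passed, and its exhaustion says that `k` is not above nominal.
    have h2 : w k < w j := by
      by_contra! hle
      nlinarith [mul_nonneg (sub_nonneg.2 hνμ) (sub_nonneg.2 hle)]
    obtain ⟨hst, hsl⟩ := isStored_C2_of_lt hν h2 hlt
    exact absurd ((hex _ hst hsl).1 h2) (not_le.2 hk)
  donor k hk := by
    obtain ⟨j, hj⟩ := hdon k hk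
    refine ⟨j, ?_⟩
    nlinarith [mul_le_mul_of_nonneg_right hνμ (hw j).le, mul_le_mul_of_nonneg_right hνμ (hw k).le]
  keep k hk j := by
    by_contra! hlt
    -- The entry `C1 j k` has been passed, so the donor `k` is already empty.
    obtain ⟨hst, hsl⟩ := isStored_C1_of_lt hw hν hlt
    exact hk.ne' (hex _ hst hsl)

/-! ### Transfers of mass -/

/-- The state consists of a distribution, its distance from `pbar` and its objective value. -/
structure State.IsConsistent {S : ℕ} (z w pbar : Fin S → ℝ) (s : State S) : Prop where
  mem : s.p ∈ stdSimplex ℝ (Fin S)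
  norm : wnorm w (s.p - pbar) = s.ξ
  value : s.p ⬝ᵥ z = s.q

/-- The point `p'` is obtained from `p` by moving the mass `δ` from `b` to `a`. -/
structure IsTransfer {S : ℕ} (p p' : Fin S → ℝ) (a b : Fin S) (δ : ℝ) : Prop where
  ne : a ≠ b
  nonneg : 0 ≤ δ
  receiver : p' a = p a + δ
  donor : p' b = p b - δ
  other : ∀ k, k ≠ a → k ≠ b → p' k = p k

theorem sum_eq_of_forall_ne {S : ℕ} {f g : Fin S → ℝ} {a b : Fin S} (hab : a ≠ b)
    (h : ∀ k, k ≠ a → k ≠ b → f k = g k) :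
    ∑ k, f k = ∑ k, g k + (f a - g a) + (f b - g b) := by
  have hsum : ∑ k, (f k - g k) = (f a - g a) + (f b - g b) :=
    Finset.sum_eq_add a b hab (fun k _ hk => sub_eq_zero.2 (h k hk.1 hk.2))
      (fun ha => absurd (Finset.mem_univ a) ha) (fun hb => absurd (Finset.mem_univ b) hb)
  rw [Finset.sum_sub_distrib] at hsum
  linarith

/-- The receiver is at or above nominal, so it adds `δ * w a` to the norm. The donor's contribution
stays general: it grows in case C1 (moving away from nominal) and shrinks in case C2 (returning to
it). -/
theorem IsTransfer.isConsistent {S : ℕ} {z w pbar : Fin S → ℝ} {s s' : State S} {a b : Fin S}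
    {δ : ℝ} (ht : IsTransfer s.p s'.p a b δ) (hs : s.IsConsistent z w pbar)
    (ha : pbar a ≤ s.p a) (hδ : δ ≤ s.p b)
    (hξ : s'.ξ = s.ξ + δ * w a + w b * (|s'.p b - pbar b| - |s.p b - pbar b|))
    (hq : s'.q = s.q + δ * (z a - z b)) : s'.IsConsistent z w pbar := by
  refine ⟨⟨fun k => ?_, ?_⟩, ?_, ?_⟩
  · by_cases hka : k = a
    · rw [hka, ht.receiver]
      exact add_nonneg (hs.mem.1 a) ht.nonneg
    by_cases hkb : k = b
    · rw [hkb, ht.donor]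
      linarith
    rw [ht.other k hka hkb]
    exact hs.mem.1 k
  · rw [sum_eq_of_forall_ne ht.ne ht.other, hs.mem.2, ht.receiver, ht.donor]
    ring
  · rw [hξ, ← hs.norm]
    unfold wnorm
    rw [sum_eq_of_forall_ne (g := fun k => w k * |(s.p - pbar) k|) ht.ne]
    · simp only [Pi.sub_apply]
      rw [ht.receiver, abs_of_nonneg (sub_nonneg.2 ha),
        abs_of_nonneg (by linarith [ht.nonneg] : 0 ≤ s.p a + δ - pbar a)]
      ring
    · intro k hka hkb
      simp only [Pi.sub_apply, ht.other k hka hkb]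
  · rw [hq, ← hs.value]
    unfold dotProduct
    rw [sum_eq_of_forall_ne (g := fun k => s.p k * z k) ht.ne, ht.receiver, ht.donor]
    · ring
    · intro k hka hkb
      rw [ht.other k hka hkb]

/-- Only `a` gains mass, and it is a cheapest receiver. The donor condition needs checking only if
`b` ends below nominal, where `a` itself is the witness. -/
theorem IsTransfer.isDualOptimal {S : ℕ} {z w pbar p p' : Fin S → ℝ} {a b : Fin S} {δ μ : ℝ}
    (ht : IsTransfer p p' a b δ) (hw : ∀ k, 0 < w k) (hμ : 0 ≤ μ)
    (hopt : IsDualOptimal z w pbar μ p) (ha : IsReceiver z w μ a) (hpa : pbar a ≤ p a)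
    (hb : p' b < pbar b → z a + μ * w a ≤ z b - μ * w b) :
    IsDualOptimal z w pbar μ p' := by
  have hδ := ht.nonneg
  refine ⟨fun k hk => ?_, fun k hk => ?_, fun k hk => ?_⟩ <;>
  by_cases hka : k = a
  · exact hka ▸ ha
  · refine hopt.receiver k ?_
    by_cases hkb : k = b
    · subst hkb
      linarith [ht.donor]
    · rwa [← ht.other k hka hkb]
  · subst hka
    linarith [ht.receiver]
  · by_cases hkb : k = b
    · subst hkb
      exact ⟨a, hb hk⟩
    · exact hopt.donor k (by rwa [← ht.other k hka hkb])
  · subst hka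
    intro j
    nlinarith [ha j, mul_nonneg hμ (hw k).le]
  · refine hopt.keep k ?_
    by_cases hkb : k = b
    · subst hkb
      linarith [ht.donor]
    · rwa [← ht.other k hka hkb]

/-- Only the receiver `a` could undo exhaustion, by being the donor of an earlier entry. For `C1 i
a`, the tie at a multiplier at least `μ` would make `i` strictly cheaper than `a` at `μ`; for a
heavier `i` paired with `a` in C2, it would make `i` tie with `a` at `μ`, which `htie` excludes. -/
theorem IsTransfer.exhausted {S : ℕ} {z w pbar p p' : Fin S → ℝ} {a b : Fin S} {δ μ : ℝ}
    (ht : IsTransfer p p' a b δ) (hw : ∀ k, 0 < w k) (hμ : 0 < μ)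
    (ha : IsReceiver z w μ a) (hb : 0 ≤ p' b)
    (htie : ∀ k, w a < w k → z a + μ * w a ≠ z k + μ * w k)
    {e : Entry S} (he : e.IsStored z w) (hle : e.slope z w ≤ -μ) (hex : Exhausted w pbar p e) :
    Exhausted w pbar p' e := by
  have hδ := ht.nonneg
  have hkey : ∀ i j, w j < w i → z i - e.slope z w * w i = z j - e.slope z w * w j →
      p j ≤ pbar j → p' j ≤ pbar j := by
    intro i j hij heq hpj
    by_cases hja : j = a
    · subst hja
      refine absurd ((ha i).antisymm ?_) (htie i hij)
      nlinarith [mul_nonneg (sub_nonneg.2 hle) (sub_nonneg.2 hij.le)]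
    by_cases hjb : j = b
    · subst hjb
      linarith [ht.donor]
    rwa [ht.other j hja hjb]
  cases e with
  | C1 i j =>
    change p' j = 0
    change p j = 0 at hex
    by_cases hja : j = a
    · subst hja
      have h1 := slope_C1_tie (z := z) hw i j
      have h2 := ha i
      have h3 := mul_le_mul_of_nonneg_right hle (hw i).le
      have h4 := mul_le_mul_of_nonneg_right hle (hw j).le
      have h5 := mul_pos hμ (hw j)
      linarith
    by_cases hjb : j = b
    · subst hjb
      linarith [ht.donor]
    rw [ht.other j hja hjb, hex]
  | C2 i j =>
    have h1 := slope_C2_tie (z := z) he.2.1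
    exact ⟨fun hij => hkey i j hij h1 (hex.1 hij), fun hij => hkey j i hij h1.symm (hex.2 hij)⟩

/-! ### Feasible bases -/

theorem Entry.Feasible.le_of_mem {S : ℕ} {w pbar p : Fin S → ℝ} {ξ : ℝ} {d : Entry S}
    (h : d.Feasible w pbar ξ p) {k : Fin S} (hk : k ∈ d.basis.1) : pbar k ≤ p k := by
  obtain ⟨B, l, hU, -, -, hf, hact⟩ := h
  have h1 := hact k
  rw [(hU k).2 hk] at h1
  change p k - pbar k = l k at h1
  linarith [hf.2.1 k]

/-- Take `l = |p - pbar|`. Components outside the entry use two constraints each, `E` at nominal and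
`Lbar` at zero; the two components of the entry use one each, for a total of `2 * S - 2`. -/
theorem Entry.feasible_of_forall {S : ℕ} {z w pbar : Fin S → ℝ} {s : State S} {d : Entry S}
    (hpbar : pbar ∈ stdSimplex ℝ (Fin S)) (hs : s.IsConsistent z w pbar)
    (hdisj : Disjoint d.basis.1 d.basis.2) (hcard : d.basis.1.card + d.basis.2.card = 2)
    (hU : ∀ k ∈ d.basis.1, pbar k ≤ s.p k) (hL : ∀ k ∈ d.basis.2, s.p k ≤ pbar k)
    (hO : ∀ k, k ∉ d.basis.1 → k ∉ d.basis.2 → s.p k = pbar k ∨ s.p k = 0) :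
    d.Feasible w pbar s.ξ s.p := by
  classical
  let B : Fin S → Status := fun k =>
    if k ∈ d.basis.1 then .U else if k ∈ d.basis.2 then .L
    else if s.p k = pbar k then .E else .Lbar
  have hB1 : ∀ k, B k = .U ↔ k ∈ d.basis.1 := by
    intro k
    simp only [B]
    split_ifs <;> simp_all
  have hB2 : ∀ k, B k = .L ↔ k ∈ d.basis.2 := by
    intro k
    have : k ∈ d.basis.1 → k ∉ d.basis.2 := fun h => Finset.disjoint_left.1 hdisj h
    simp only [B]
    split_ifs <;> simp_all
  refine ⟨B, fun k => |s.p k - pbar k|, hB1, hB2, ?_, ⟨fun k => le_abs_self _, fun k => ?_,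
    hs.mem.1, hs.mem.2, hs.norm⟩, fun k => ?_⟩
  · have hterm : ∀ k, (B k).count + ((if k ∈ d.basis.1 then 1 else 0) +
        (if k ∈ d.basis.2 then 1 else 0)) = 2 := by
      intro k
      have : k ∈ d.basis.1 → k ∉ d.basis.2 := fun h => Finset.disjoint_left.1 hdisj h
      simp only [B]
      split_ifs <;> simp_all [Status.count]
    have hsum := Finset.sum_congr rfl fun k (_ : k ∈ Finset.univ) => hterm k
    rw [Finset.sum_add_distrib, Finset.sum_add_distrib] at hsum
    simp only [Finset.sum_ite_mem, Finset.univ_inter, Finset.sum_const, Finset.card_univ,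
      Fintype.card_fin, smul_eq_mul, mul_one] at hsum
    omega
  · rw [← neg_sub]
    exact neg_le_abs _
  · simp only [B]
    split_ifs with h1 h2 h3
    · exact (abs_of_nonneg (sub_nonneg.2 (hU k h1))).symm
    · exact ((abs_of_nonpos (sub_nonpos.2 (hL k h2))).trans (neg_sub _ _)).symm
    · simp [Status.Active, h3]
    · have h0 := (hO k h1 h2).resolve_left h3
      refine ⟨?_, h0⟩
      rw [h0, zero_sub, abs_neg, sub_zero, abs_of_nonneg (hpbar.1 k)]

theorem csSup_steps {x c κ : ℝ} (hc : c ≤ x) (hκ : 0 < κ) :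
    sSup {Δ : ℝ | 0 ≤ Δ ∧ c ≤ x + Δ * (-(1 / κ))} = (x - c) * κ := by
  refine IsGreatest.csSup_eq ⟨⟨mul_nonneg (sub_nonneg.2 hc) hκ.le, ?_⟩, fun Δ hΔ => ?_⟩
  · refine le_of_eq ?_
    field_simp
    ring
  · have h1 : Δ / κ ≤ x - c := by
      have := hΔ.2
      rw [div_eq_mul_one_div]
      linarith
    exact (div_le_iff₀ hκ).1 h1

theorem csSup_steps_C1 {S : ℕ} {w pbar p : Fin S → ℝ} (hw : ∀ k, 0 < w k) {i j : Fin S}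
    (hij : i ≠ j) (hp : 0 ≤ p j) :
    sSup ((Entry.C1 i j).steps w pbar p) = p j * (w i + w j) := by
  have h := csSup_steps hp (add_pos (hw i) (hw j))
  rw [sub_zero] at h
  rw [← h]
  simp [Entry.steps, Entry.pdot, Pi.single_eq_of_ne hij.symm]

theorem csSup_steps_C2 {S : ℕ} {w pbar p : Fin S → ℝ} {i j : Fin S}
    (hij : w j < w i) (hp : pbar j ≤ p j) :
    sSup ((Entry.C2 i j).steps w pbar p) = (p j - pbar j) * (w i - w j) := by
  have hne : j ≠ i := fun h => hij.ne (h ▸ rfl)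
  rw [← csSup_steps hp (sub_pos.2 hij)]
  simp [Entry.steps, Entry.pdot, Pi.single_eq_of_ne hne, hij]

/-- Numerators and denominators change sign together and `steps` switches branch, so the heavier
component may be assumed to come first. -/
theorem step_C2_comm {S : ℕ} {z w pbar : Fin S → ℝ} {s : State S} {i j : Fin S}
    (hij : w i ≠ w j) : step z w pbar s (.C2 i j) = step z w pbar s (.C2 j i) := by
  have hpdot : (Entry.C2 i j).pdot w = (Entry.C2 j i).pdot w := by
    have h : 1 / (w i - w j) = -(1 / (w j - w i)) := by
      rw [← neg_sub, one_div_neg_eq_neg_one_div]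
    simp only [Entry.pdot, h, Pi.single_neg]
    abel
  have hslope : (Entry.C2 i j).slope z w = (Entry.C2 j i).slope z w := by
    simp only [Entry.slope]
    rw [← neg_sub (z j), ← neg_sub (w j), neg_div_neg_eq]
  have hfeas : (Entry.C2 i j).Feasible w pbar s.ξ s.p ↔
      (Entry.C2 j i).Feasible w pbar s.ξ s.p := by
    simp only [Entry.Feasible, Entry.basis, Finset.pair_comm i j]
  have hsteps : (Entry.C2 i j).steps w pbar s.p = (Entry.C2 j i).steps w pbar s.p := by
    simp only [Entry.steps, hpdot]
    rcases lt_or_gt_of_ne hij with h | h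
    · rw [if_neg (not_lt.2 h.le), if_pos h]
    · rw [if_pos h, if_neg (not_lt.2 h.le)]
  by_cases hf : (Entry.C2 j i).Feasible w pbar s.ξ s.p
  · rw [step, step, if_pos hf, if_pos (hfeas.2 hf), hsteps, hpdot, hslope]
  · rw [step, step, if_neg hf, if_neg (hfeas.not.2 hf)]

theorem exhausted_C2_comm {S : ℕ} {w pbar p : Fin S → ℝ} {i j : Fin S} :
    Exhausted w pbar p (.C2 i j) ↔ Exhausted w pbar p (.C2 j i) := and_comm

theorem step_eq_self {S : ℕ} {z w pbar : Fin S → ℝ} {s : State S} {d : Entry S}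
    (h : d.Feasible w pbar s.ξ s.p → sSup (d.steps w pbar s.p) = 0) :
    step z w pbar s d = s := by
  by_cases hf : d.Feasible w pbar s.ξ s.p
  · rw [step, if_pos hf]
    simp [h hf]
  · rw [step, if_neg hf]

/-- The basis may still be feasible, but then the donor sits at its bound and the step length is
zero. In case C2, feasibility supplies the inequality opposite to exhaustion. -/
theorem step_of_exhausted {S : ℕ} {z w pbar : Fin S → ℝ} (hw : ∀ k, 0 < w k) {s : State S}
    {d : Entry S} (hd : d.IsStored z w) (hex : Exhausted w pbar s.p d) :
    step z w pbar s d = s := by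
  have hC2 : ∀ i j, w j < w i → s.p j ≤ pbar j → step z w pbar s (.C2 i j) = s := by
    intro i j hij hle
    refine step_eq_self fun hf => ?_
    have hge : pbar j ≤ s.p j := hf.le_of_mem (by simp [Entry.basis])
    rw [csSup_steps_C2 hij hge, hle.antisymm hge, sub_self, zero_mul]
  cases d with
  | C1 i j =>
    change s.p j = 0 at hex
    refine step_eq_self fun _ => ?_
    rw [csSup_steps_C1 hw hd.1 hex.ge, hex, zero_mul]
  | C2 i j =>
    rcases lt_or_gt_of_ne hd.2.1 with h | h
    · rw [step_C2_comm hd.2.1]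
      exact hC2 j i h (hex.2 h)
    · exact hC2 i j h (hex.1 h)

/-! ### One iteration of the loop -/

/-- The effect of one iteration of the tracing loop. -/
structure IsTracingStep {S : ℕ} (z w pbar : Fin S → ℝ) (s s' : State S) (d : Entry S) :
    Prop where
  consistent : s'.IsConsistent z w pbar
  le : s.ξ ≤ s'.ξ
  dualOptimal : IsDualOptimal z w pbar (-d.slope z w) s'.p
  exhausted_self : Exhausted w pbar s'.p d
  exhausted : ∀ e : Entry S, e.IsStored z w → e.slope z w ≤ d.slope z w →
    Exhausted w pbar s.p e → Exhausted w pbar s'.p e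

/-- A component that is neither at its nominal value nor at zero, while `a` is a receiver, forms
a stored entry together with `a`. -/
theorem eq_or_eq_zero_of_isReceiver {S : ℕ} {z w pbar p : Fin S → ℝ} {μ : ℝ} {a k : Fin S}
    (ha : IsReceiver z w μ a) (hp : 0 ≤ p k) (hopt : IsDualOptimal z w pbar μ p)
    (h1 : z a + μ * w a ≠ z k + μ * w k) (h2 : z a + μ * w a ≠ z k - μ * w k) :
    p k = pbar k ∨ p k = 0 := by
  rcases lt_trichotomy (p k) (pbar k) with h | h | h
  · refine Or.inr (hp.eq_or_lt.resolve_right fun hpos => h2 ?_).symm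
    obtain ⟨j, hj⟩ := hopt.donor k h
    exact ((ha j).trans hj).antisymm (hopt.keep k hpos a)
  · exact Or.inl h
  · exact absurd ((ha k).antisymm (hopt.receiver k h a)) h1

/-- Below nominal, some `j` would receive at cost at most `z a - μ * w a`, strictly less than the
minimal cost `z a + μ * w a`. -/
theorem IsReceiver.le_of_isDualOptimal {S : ℕ} {z w pbar p : Fin S → ℝ} {μ : ℝ} {a : Fin S}
    (ha : IsReceiver z w μ a) (hμ : 0 < μ) (hw : ∀ k, 0 < w k)
    (hopt : IsDualOptimal z w pbar μ p) : pbar a ≤ p a := by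
  by_contra! hlt
  obtain ⟨j, hj⟩ := hopt.donor a hlt
  nlinarith [ha j, mul_pos hμ (hw a)]

theorem isTransfer_pdot {S : ℕ} {p : Fin S → ℝ} {a b : Fin S} (hab : a ≠ b) {Δ c : ℝ}
    (h : 0 ≤ Δ * c) : IsTransfer p (p + Δ • (Pi.single a c - Pi.single b c)) a b (Δ * c) where
  ne := hab
  nonneg := h
  receiver := by simp [Pi.single_eq_of_ne hab]
  donor := by simp [Pi.single_eq_of_ne hab.symm, sub_eq_add_neg]
  other k hka hkb := by simp [Pi.single_eq_of_ne hka, Pi.single_eq_of_ne hkb]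

theorem isTracingStep_of_exhausted {S : ℕ} {z w pbar : Fin S → ℝ} (hw : ∀ k, 0 < w k)
    {s : State S} {d : Entry S} (hd : d.IsStored z w) (hs : s.IsConsistent z w pbar)
    (hopt : IsDualOptimal z w pbar (-d.slope z w) s.p) (hex : Exhausted w pbar s.p d) :
    IsTracingStep z w pbar s (step z w pbar s d) d := by
  rw [step_of_exhausted hw hd hex]
  exact ⟨hs, le_rfl, hopt, hex, fun _ _ _ h => h⟩

theorem isTracingStep_C1 {S : ℕ} {z w pbar : Fin S → ℝ} (hw : ∀ k, 0 < w k)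
    (hpbar : pbar ∈ stdSimplex ℝ (Fin S)) (hslopes : DistinctSlopes z w) {s : State S}
    {i j : Fin S} (hd : (Entry.C1 i j).IsStored z w) (hs : s.IsConsistent z w pbar)
    (hopt : IsDualOptimal z w pbar (-(Entry.C1 i j).slope z w) s.p) :
    IsTracingStep z w pbar s (step z w pbar s (.C1 i j)) (.C1 i j) := by
  by_cases hex : Exhausted w pbar s.p (.C1 i j)
  · exact isTracingStep_of_exhausted hw hd hs hopt hex
  have hpj : 0 < s.p j := (hs.mem.1 j).lt_of_ne fun h => hex h.symm
  have hij : i ≠ j := hd.1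
  have htie := slope_C1_tie (z := z) hw i j
  have hμ : 0 < -(Entry.C1 i j).slope z w := neg_pos.2 hd.2
  obtain ⟨μ, hμdef⟩ : ∃ μ, μ = -(Entry.C1 i j).slope z w := ⟨_, rfl⟩
  have hslope : (Entry.C1 i j).slope z w = -μ := by rw [hμdef, neg_neg]
  rw [← hμdef] at hopt hμ
  rw [hslope] at htie
  have htie' : z i + μ * w i = z j - μ * w j := by linarith
  -- A donor that still holds mass saves at most the cheapest receiving cost, and the tie says that
  -- `i` attains this bound.
  have hi : IsReceiver z w μ i := fun k => htie'.trans_le (hopt.keep j hpj k)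
  have hpi := hi.le_of_isDualOptimal hμ hw hopt
  have hunique : ∀ e : Entry S, e.IsStored z w → e.slope z w = -μ →
      e.basis = (Entry.C1 i j).basis := by
    intro e he hes
    by_contra hne
    exact hslopes e _ he hd hne (hes.trans hslope.symm)
  have hrec : ∀ k, k ≠ i → z i + μ * w i ≠ z k + μ * w k := by
    intro k hki heq
    -- For equal weights `C2 k i` is not stored; then `k` also ties with the donor, and `C1 k j` is
    -- the conflicting entry.
    by_cases hwk : w k = w i
    · obtain ⟨h1, h2⟩ := isStored_C1_of_eq hw hμ (heq.symm.trans htie')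
      have := hunique _ h1 h2
      simp only [Entry.basis, Prod.mk.injEq, Finset.singleton_inj, and_true] at this
      exact hki this
    · obtain ⟨h1, h2⟩ := isStored_C2_of_eq hμ hwk heq.symm
      have := hunique _ h1 h2
      simp [Entry.basis] at this
  have hpj' : s.p j ≤ pbar j := by
    by_contra! hlt
    have := hopt.receiver j hlt i
    nlinarith [mul_pos hμ (hw j)]
  have hf : (Entry.C1 i j).Feasible w pbar s.ξ s.p := by
    refine Entry.feasible_of_forall hpbar hs ?_ ?_ ?_ ?_ ?_
    · simpa [Entry.basis] using hij
    · simp [Entry.basis]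
    · simpa [Entry.basis] using hpi
    · simpa [Entry.basis] using hpj'
    · intro k hki hkj
      simp only [Entry.basis, Finset.mem_singleton] at hki hkj
      refine eq_or_eq_zero_of_isReceiver hi (hs.mem.1 k) hopt (hrec k hki) fun heq => ?_
      obtain ⟨h1, h2⟩ := isStored_C1_of_eq hw hμ heq
      have := hunique _ h1 h2
      simp only [Entry.basis, Prod.mk.injEq, Finset.singleton_inj, true_and] at this
      exact hkj this
  have hκ := add_pos (hw i) (hw j)
  have hδ : s.p j * (w i + w j) * (1 / (w i + w j)) = s.p j := by
    field_simp
  have ht := isTransfer_pdot (p := s.p) hij (Δ := s.p j * (w i + w j)) (c := 1 / (w i + w j))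
    (by rw [hδ]; exact hpj.le)
  rw [step, if_pos hf, csSup_steps_C1 hw hij hpj.le]
  simp only [Entry.pdot]
  have hpj0 := ht.donor
  rw [hδ] at ht hpj0
  rw [sub_self] at hpj0
  have hcons : State.IsConsistent z w pbar _ := IsTransfer.isConsistent
    (s' := ⟨s.ξ + s.p j * (w i + w j), _, s.q + s.p j * (w i + w j) * (Entry.C1 i j).slope z w⟩)
    ht hs hpi le_rfl (by
      simp only
      rw [hpj0, abs_of_nonpos (by linarith [hpbar.1 j]), abs_of_nonpos (by linarith)]
      ring) (by
      simp only
      rw [hslope]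
      linear_combination (-s.p j) * htie')
  refine ⟨hcons, ?_, ?_, hpj0, fun e he hle hexe => ?_⟩
  · simp only
    nlinarith
  · rw [← hμdef]
    exact ht.isDualOptimal hw hμ.le hopt hi hpi fun _ => htie'.le
  · exact ht.exhausted hw hμ hi hpj0.ge (fun k hk => hrec k fun h => hk.ne (h ▸ rfl)) he
      (hle.trans_eq hslope) hexe

theorem isTracingStep_C2 {S : ℕ} {z w pbar : Fin S → ℝ} (hw : ∀ k, 0 < w k)
    (hpbar : pbar ∈ stdSimplex ℝ (Fin S)) (hslopes : DistinctSlopes z w) {s : State S}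
    {i j : Fin S} (hij : w j < w i) (hd : (Entry.C2 i j).IsStored z w)
    (hs : s.IsConsistent z w pbar)
    (hopt : IsDualOptimal z w pbar (-(Entry.C2 i j).slope z w) s.p) :
    IsTracingStep z w pbar s (step z w pbar s (.C2 i j)) (.C2 i j) := by
  by_cases hex : Exhausted w pbar s.p (.C2 i j)
  · exact isTracingStep_of_exhausted hw hd hs hopt hex
  have hpj : pbar j < s.p j := by
    by_contra! hle
    exact hex ⟨fun _ => hle, fun h => absurd h hij.not_gt⟩
  have hne : i ≠ j := hd.1
  have htie := slope_C2_tie (z := z) hij.ne'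
  have hμ : 0 < -(Entry.C2 i j).slope z w := neg_pos.2 hd.2.2
  obtain ⟨μ, hμdef⟩ : ∃ μ, μ = -(Entry.C2 i j).slope z w := ⟨_, rfl⟩
  have hslope : (Entry.C2 i j).slope z w = -μ := by rw [hμdef, neg_neg]
  rw [← hμdef] at hopt hμ
  rw [hslope] at htie
  have htie' : z i + μ * w i = z j + μ * w j := by linarith
  have hi : IsReceiver z w μ i := fun k => htie'.trans_le (hopt.receiver j hpj k)
  have hpi := hi.le_of_isDualOptimal hμ hw hopt
  have hunique : ∀ e : Entry S, e.IsStored z w → e.slope z w = -μ →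
      e.basis = (Entry.C2 i j).basis := by
    intro e he hes
    by_contra hne
    exact hslopes e _ he hd hne (hes.trans hslope.symm)
  have hrec : ∀ k, k ≠ i → k ≠ j → z i + μ * w i ≠ z k + μ * w k := by
    intro k hki hkj heq
    -- A third component tied with some `a` of different weight would give a stored entry at the
    -- same slope whose basis contains `k`. Since `w i ≠ w j`, at least one of `i`, `j` can serve as
    -- `a`.
    have hmem : ∀ a, w k ≠ w a → z k + μ * w k = z a + μ * w a → False := by
      intro a hwa heqa
      obtain ⟨h1, h2⟩ := isStored_C2_of_eq hμ hwa heqa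
      have h3 : k ∈ (Entry.C2 i j).basis.1 := by
        rw [← hunique _ h1 h2]
        simp [Entry.basis]
      simp [Entry.basis, hki, hkj] at h3
    by_cases hwk : w k = w i
    · exact hmem j (hwk.trans_ne hij.ne') (heq.symm.trans htie')
    · exact hmem i hwk heq.symm
  have hf : (Entry.C2 i j).Feasible w pbar s.ξ s.p := by
    refine Entry.feasible_of_forall hpbar hs ?_ ?_ ?_ ?_ ?_
    · simp [Entry.basis]
    · simp [Entry.basis, Finset.card_pair hne]
    · simpa [Entry.basis] using ⟨hpi, hpj.le⟩
    · simp [Entry.basis]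
    · intro k hk _
      simp only [Entry.basis, Finset.mem_insert, Finset.mem_singleton, not_or] at hk
      refine eq_or_eq_zero_of_isReceiver hi (hs.mem.1 k) hopt (hrec k hk.1 hk.2) fun heq => ?_
      obtain ⟨h1, h2⟩ := isStored_C1_of_eq hw hμ heq
      have := hunique _ h1 h2
      simp [Entry.basis] at this
  have hκ := sub_pos.2 hij
  have hδ : (s.p j - pbar j) * (w i - w j) * (1 / (w i - w j)) = s.p j - pbar j := by
    field_simp
  have ht := isTransfer_pdot (p := s.p) hne (Δ := (s.p j - pbar j) * (w i - w j))
    (c := 1 / (w i - w j)) (by rw [hδ]; linarith)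
  rw [step, if_pos hf, csSup_steps_C2 hij hpj.le]
  simp only [Entry.pdot]
  have hpj0 := ht.donor
  rw [hδ] at ht hpj0
  rw [sub_sub_cancel] at hpj0
  have hcons : State.IsConsistent z w pbar _ := IsTransfer.isConsistent
    (s' := ⟨s.ξ + (s.p j - pbar j) * (w i - w j), _,
      s.q + (s.p j - pbar j) * (w i - w j) * (Entry.C2 i j).slope z w⟩)
    ht hs hpi (by linarith [hpbar.1 j]) (by
      simp only
      rw [hpj0, sub_self, abs_zero, abs_of_pos (by linarith)]
      ring) (by
      simp only
      rw [hslope]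
      linear_combination (pbar j - s.p j) * htie')
  refine ⟨hcons, ?_, ?_, ⟨fun _ => hpj0.le, fun h => absurd h hij.not_gt⟩,
    fun e he hle hexe => ?_⟩
  · simp only
    nlinarith
  · rw [← hμdef]
    exact ht.isDualOptimal hw hμ.le hopt hi hpi fun h => absurd hpj0 h.ne
  -- The donor `j` does tie with `i`, but it is lighter, so it is outside the range of the tie
  -- condition.
  · refine ht.exhausted hw hμ hi ((hpbar.1 j).trans_eq hpj0.symm) (fun k hk => ?_) he
      (hle.trans_eq hslope) hexe
    exact hrec k (fun h => hk.ne (h ▸ rfl)) fun h => (hij.trans hk).ne (h ▸ rfl)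

theorem isTracingStep_step {S : ℕ} {z w pbar : Fin S → ℝ} (hw : ∀ k, 0 < w k)
    (hpbar : pbar ∈ stdSimplex ℝ (Fin S)) (hslopes : DistinctSlopes z w) {s : State S}
    {d : Entry S} (hd : d.IsStored z w) (hs : s.IsConsistent z w pbar)
    (hopt : IsDualOptimal z w pbar (-d.slope z w) s.p) :
    IsTracingStep z w pbar s (step z w pbar s d) d := by
  cases d with
  | C1 i j => exact isTracingStep_C1 hw hpbar hslopes hd hs hopt
  | C2 i j =>
    rcases lt_or_gt_of_ne hd.2.1 with h | h
    · have hslope : (Entry.C2 i j).slope z w = (Entry.C2 j i).slope z w := by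
        simp only [Entry.slope]
        rw [← neg_sub (z j), ← neg_sub (w j), neg_div_neg_eq]
      have hd' : (Entry.C2 j i).IsStored z w := ⟨hd.1.symm, hd.2.1.symm, hslope ▸ hd.2.2⟩
      rw [hslope] at hopt
      rw [step_C2_comm hd.2.1]
      have hstep := isTracingStep_C2 hw hpbar hslopes h hd' hs hopt
      exact ⟨hstep.consistent, hstep.le, hslope ▸ hstep.dualOptimal,
        exhausted_C2_comm.1 hstep.exhausted_self, hslope ▸ hstep.exhausted⟩
    · exact isTracingStep_C2 hw hpbar hslopes h hd hs hopt

end Homotopy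


namespace Homotopy

/-! ### The tracing loop -/

theorem trace_succ {S : ℕ} (z w pbar : Fin S → ℝ) (D : List (Entry S)) {t : ℕ}
    (ht : t < D.length) :
    trace z w pbar D (t + 1) = step z w pbar (trace z w pbar D t) D[t] := by
  rw [trace, List.take_succ_eq_append_getElem ht, List.foldl_append]
  rfl

theorem IsSortedList.slope_le_of_mem_take {S : ℕ} {z w : Fin S → ℝ} {D : List (Entry S)}
    (hD : IsSortedList z w D) {t : ℕ} (ht : t < D.length) {e : Entry S} (he : e ∈ D.take t) :
    e.slope z w ≤ D[t].slope z w := by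
  have h := hD.2.2
  rw [← List.take_append_drop t D, List.pairwise_append] at h
  exact h.2.2 e he _ (List.drop_eq_getElem_cons ht ▸ List.mem_cons_self)

theorem IsSortedList.mem_take_of_slope_lt {S : ℕ} {z w : Fin S → ℝ} {D : List (Entry S)}
    (hD : IsSortedList z w D) {t : ℕ} (ht : t < D.length) {e : Entry S} (he : e.IsStored z w)
    (hlt : e.slope z w < D[t].slope z w) : e ∈ D.take t := by
  have hmem := (hD.2.1 e).2 he
  rw [← List.take_append_drop t D, List.mem_append] at hmem
  refine hmem.resolve_right fun hdrop => ?_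
  have h := hD.2.2.sublist (List.drop_sublist t D)
  rw [List.drop_eq_getElem_cons ht] at h hdrop
  rcases List.mem_cons.1 hdrop with rfl | h'
  · exact lt_irrefl _ hlt
  · exact hlt.not_ge ((List.pairwise_cons.1 h).1 e h')

/-- The invariant of the tracing loop after `t` iterations. -/
structure TraceInvariant {S : ℕ} (z w pbar : Fin S → ℝ) (D : List (Entry S)) (t : ℕ) :
    Prop where
  consistent : (trace z w pbar D t).IsConsistent z w pbar
  exhausted : ∀ e ∈ D.take t, Exhausted w pbar (trace z w pbar D t).p e
  dualOptimal : ∀ μ : ℝ, 0 ≤ μ → (∀ e ∈ D.take t, μ ≤ -e.slope z w) →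
    (∀ e : Entry S, e.IsStored z w → e.slope z w < -μ → e ∈ D.take t) →
    IsDualOptimal z w pbar μ (trace z w pbar D t).p

theorem TraceInvariant.zero {S : ℕ} {z w pbar : Fin S → ℝ} (hw : ∀ k, 0 < w k)
    (hpbar : pbar ∈ stdSimplex ℝ (Fin S)) (D : List (Entry S)) :
    TraceInvariant z w pbar D 0 := by
  refine ⟨⟨hpbar, by simp [trace, initial, wnorm], rfl⟩, by simp, fun μ hμ _ h => ?_⟩
  -- At `pbar` nothing is above or below nominal, so the receiver and donor conditions are vacuous;
  -- no stored entry lies beyond `μ`, which gives the rest.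
  refine isDualOptimal_of_le (μ := μ) hw (fun k hk => absurd hk (lt_irrefl _))
    (fun k hk => absurd hk (lt_irrefl _)) hμ le_rfl fun e he hlt => ?_
  simpa using h e he hlt

/-- By sortedness, the multiplier of the next entry is admissible in the invariant. -/
theorem TraceInvariant.isDualOptimal_slope {S : ℕ} {z w pbar : Fin S → ℝ}
    {D : List (Entry S)} (hD : IsSortedList z w D) {t : ℕ} (ht : t < D.length)
    (h : TraceInvariant z w pbar D t) :
    IsDualOptimal z w pbar (-D[t].slope z w) (trace z w pbar D t).p := by
  refine h.dualOptimal _ ?_ (fun e he => ?_) (fun e he hlt => ?_)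
  · exact (neg_pos.2 ((hD.2.1 _).1 (List.getElem_mem ht)).slope_neg).le
  · exact neg_le_neg (hD.slope_le_of_mem_take ht he)
  · rw [neg_neg] at hlt
    exact hD.mem_take_of_slope_lt ht he hlt

theorem TraceInvariant.isTracingStep {S : ℕ} {z w pbar : Fin S → ℝ} (hw : ∀ k, 0 < w k)
    (hpbar : pbar ∈ stdSimplex ℝ (Fin S)) (hslopes : DistinctSlopes z w)
    {D : List (Entry S)} (hD : IsSortedList z w D) {t : ℕ} (ht : t < D.length)
    (h : TraceInvariant z w pbar D t) :
    IsTracingStep z w pbar (trace z w pbar D t) (trace z w pbar D (t + 1)) D[t] := by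
  rw [trace_succ z w pbar D ht]
  exact isTracingStep_step hw hpbar hslopes ((hD.2.1 _).1 (List.getElem_mem ht)) h.consistent
    (h.isDualOptimal_slope hD ht)

theorem TraceInvariant.succ {S : ℕ} {z w pbar : Fin S → ℝ} (hw : ∀ k, 0 < w k)
    (hpbar : pbar ∈ stdSimplex ℝ (Fin S)) (hslopes : DistinctSlopes z w)
    {D : List (Entry S)} (hD : IsSortedList z w D) {t : ℕ} (ht : t < D.length)
    (h : TraceInvariant z w pbar D t) : TraceInvariant z w pbar D (t + 1) := by
  have hstep := h.isTracingStep hw hpbar hslopes hD ht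
  have hex : ∀ e ∈ D.take (t + 1), Exhausted w pbar (trace z w pbar D (t + 1)).p e := by
    intro e he
    rw [List.take_succ_eq_append_getElem ht, List.mem_append, List.mem_singleton] at he
    rcases he with he | rfl
    · exact hstep.exhausted e ((hD.2.1 e).1 (List.mem_of_mem_take he))
        (hD.slope_le_of_mem_take ht he) (h.exhausted e he)
    · exact hstep.exhausted_self
  refine ⟨hstep.consistent, hex, fun μ hμ hle hlt => ?_⟩
  have hd : D[t] ∈ D.take (t + 1) := by
    rw [List.take_succ_eq_append_getElem ht, List.mem_append, List.mem_singleton]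
    exact Or.inr rfl
  exact isDualOptimal_of_le hw hstep.dualOptimal.receiver hstep.dualOptimal.donor hμ (hle _ hd)
    fun e he he' => hex e (hlt e he he')

theorem traceInvariant {S : ℕ} {z w pbar : Fin S → ℝ} (hw : ∀ k, 0 < w k)
    (hpbar : pbar ∈ stdSimplex ℝ (Fin S)) (hslopes : DistinctSlopes z w)
    {D : List (Entry S)} (hD : IsSortedList z w D) :
    ∀ t ≤ D.length, TraceInvariant z w pbar D t
  | 0, _ => .zero hw hpbar D
  | t + 1, ht => (traceInvariant hw hpbar hslopes hD t (Nat.le_of_succ_le ht)).succ hw hpbar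
      hslopes hD ht

/-! ### The value function along the trace, and its breakpoints -/

section Output

variable {S : ℕ} {z w pbar : Fin S → ℝ} {D : List (Entry S)}

theorem trace_xi_le_succ (hw : ∀ k, 0 < w k) (hpbar : pbar ∈ stdSimplex ℝ (Fin S))
    (hslopes : DistinctSlopes z w) (hD : IsSortedList z w D) {t : ℕ} (ht : t < D.length) :
    (trace z w pbar D t).ξ ≤ (trace z w pbar D (t + 1)).ξ :=
  ((traceInvariant hw hpbar hslopes hD t ht.le).isTracingStep hw hpbar hslopes hD ht).le

theorem trace_xi_mono (hw : ∀ k, 0 < w k) (hpbar : pbar ∈ stdSimplex ℝ (Fin S))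
    (hslopes : DistinctSlopes z w) (hD : IsSortedList z w D) {s t : ℕ} (hst : s ≤ t)
    (ht : t ≤ D.length) : (trace z w pbar D s).ξ ≤ (trace z w pbar D t).ξ := by
  induction t, hst using Nat.le_induction with
  | base => exact le_rfl
  | succ t _ ih =>
    exact (ih (Nat.le_of_succ_le ht)).trans (trace_xi_le_succ hw hpbar hslopes hD ht)

/-- The states before and after the iteration are dual optimal for the same multiplier, minus the
slope of the entry. -/
theorem worstCase_eq_of_mem_Icc (hw : ∀ k, 0 < w k) (hpbar : pbar ∈ stdSimplex ℝ (Fin S))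
    (hslopes : DistinctSlopes z w) (hD : IsSortedList z w D) {t : ℕ} (ht : t < D.length) {x : ℝ}
    (hx : (trace z w pbar D t).ξ ≤ x) (hx' : x ≤ (trace z w pbar D (t + 1)).ξ) :
    worstCase z w pbar x = ((trace z w pbar D t).q - D[t].slope z w * (trace z w pbar D t).ξ) +
      D[t].slope z w * x := by
  have hinv := traceInvariant hw hpbar hslopes hD t ht.le
  have hstep := hinv.isTracingStep hw hpbar hslopes hD ht
  have hμ : 0 ≤ -D[t].slope z w :=
    (neg_pos.2 ((hD.2.1 _).1 (List.getElem_mem ht)).slope_neg).le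
  have hc := hinv.consistent
  have hc' := hstep.consistent
  have h := ((hinv.isDualOptimal_slope hD ht).isLagrangeMin hw hμ hc.mem).worstCase_eq
    (hstep.dualOptimal.isLagrangeMin hw hμ hc'.mem) hpbar hw hμ hc.mem hc'.mem
    (hc.norm.trans_le hx) (hx'.trans_eq hc'.norm.symm)
  rw [h, hc.norm, hc.value]
  ring

/-- Once the list is used up, no critical multiplier remains and the multiplier can be lowered to
`0`. -/
theorem worstCase_eq_of_ge (hw : ∀ k, 0 < w k) (hpbar : pbar ∈ stdSimplex ℝ (Fin S))
    (hslopes : DistinctSlopes z w) (hD : IsSortedList z w D) {x : EReal}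
    (hx : ((trace z w pbar D D.length).ξ : EReal) ≤ x) :
    worstCase z w pbar x = (trace z w pbar D D.length).q := by
  have hinv := traceInvariant hw hpbar hslopes hD D.length le_rfl
  have hc := hinv.consistent
  have hopt := hinv.dualOptimal 0 le_rfl
    (fun e he => (neg_pos.2 ((hD.2.1 e).1 (List.mem_of_mem_take he)).slope_neg).le)
    (fun e he _ => by rwa [List.take_length, hD.2.1])
  rw [(hopt.isLagrangeMin hw le_rfl hc.mem).worstCase_top hpbar hw hc.mem
    (by rwa [hc.norm]), hc.value]

theorem worstCase_trace_xi (hw : ∀ k, 0 < w k) (hpbar : pbar ∈ stdSimplex ℝ (Fin S))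
    (hslopes : DistinctSlopes z w) (hD : IsSortedList z w D) {t : ℕ} (ht : t ≤ D.length) :
    worstCase z w pbar (trace z w pbar D t).ξ = (trace z w pbar D t).q := by
  rcases ht.eq_or_lt with rfl | ht
  · exact worstCase_eq_of_ge hw hpbar hslopes hD le_rfl
  · rw [worstCase_eq_of_mem_Icc hw hpbar hslopes hD ht le_rfl
      (trace_xi_le_succ hw hpbar hslopes hD ht)]
    ring

/-- Iterations with the same basis cannot both move mass. -/
theorem slope_ne_of_xi_lt (hw : ∀ k, 0 < w k) (hpbar : pbar ∈ stdSimplex ℝ (Fin S))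
    (hslopes : DistinctSlopes z w) (hD : IsSortedList z w D) {s t : ℕ} (hst : s < t)
    (ht : t < D.length) (hlt : (trace z w pbar D t).ξ < (trace z w pbar D (t + 1)).ξ) :
    D[s].slope z w ≠ D[t].slope z w := by
  have hs : D[s].IsStored z w := (hD.2.1 _).1 (List.getElem_mem _)
  have ht' : D[t].IsStored z w := (hD.2.1 _).1 (List.getElem_mem _)
  refine hslopes _ _ hs ht' fun hbasis => hlt.ne ?_
  have hmem : D[s] ∈ D.take t := List.mem_take_iff_getElem.2 ⟨s, by omega, rfl⟩
  have hex := (traceInvariant hw hpbar hslopes hD t ht.le).exhausted _ hmem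
  rw [trace_succ z w pbar D ht, step_of_exhausted hw ht' (exhausted_of_basis_eq hbasis hex)]

theorem slope_eq_of_affine {f : ℝ → ℝ} {a b c m x y : ℝ} (hxy : x < y)
    (hf : ∀ᶠ u in nhds x, f u = a + b * u) (hg : ∀ u, x ≤ u → u ≤ y → f u = c + m * u) :
    b = m := by
  have h1 : ∀ᶠ u in nhdsWithin x (Set.Ioi x), f u = a + b * u := hf.filter_mono nhdsWithin_le_nhds
  have h2 : ∀ᶠ u in nhdsWithin x (Set.Ioi x), u ∈ Set.Ioo x y := Ioo_mem_nhdsGT hxy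
  obtain ⟨u, hu1, hu2⟩ := (h1.and h2).exists
  have hx := hf.self_of_nhds
  rw [hg x le_rfl hxy.le] at hx
  rw [hg u hu2.1.le hu2.2.le] at hu1
  have : (b - m) * (u - x) = 0 := by linear_combination hx - hu1
  exact sub_eq_zero.1 ((mul_eq_zero.1 this).resolve_right (sub_pos.2 hu2.1).ne')

theorem slope_eq_of_affine_left {f : ℝ → ℝ} {a b c m x y : ℝ} (hxy : y < x)
    (hf : ∀ᶠ u in nhds x, f u = a + b * u) (hg : ∀ u, y ≤ u → u ≤ x → f u = c + m * u) :
    b = m := by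
  have h1 : ∀ᶠ u in nhdsWithin x (Set.Iio x), f u = a + b * u := hf.filter_mono nhdsWithin_le_nhds
  have h2 : ∀ᶠ u in nhdsWithin x (Set.Iio x), u ∈ Set.Ioo y x := Ioo_mem_nhdsLT hxy
  obtain ⟨u, hu1, hu2⟩ := (h1.and h2).exists
  have hx := hf.self_of_nhds
  rw [hg x hxy.le le_rfl] at hx
  rw [hg u hu2.1.le hu2.2.le] at hu1
  have : (b - m) * (u - x) = 0 := by linear_combination hx - hu1
  exact sub_eq_zero.1 ((mul_eq_zero.1 this).resolve_right (sub_neg.2 hu2.2).ne)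

/-- A value between the first and the last of the `ξ_t` lies in one of the intervals. -/
theorem exists_lt_le_of_lt {f : ℕ → ℝ} {n : ℕ} {x : ℝ} {s : ℕ} (hs : f s < x) (hsn : s ≤ n)
    (hx : x ≤ f n) : ∃ t, s ≤ t ∧ t < n ∧ f t < x ∧ x ≤ f (t + 1) := by
  induction n, hsn using Nat.le_induction with
  | base => exact absurd hx hs.not_ge
  | succ n hn ih =>
    rcases lt_or_ge (f n) x with h | h
    · exact ⟨n, hn, n.lt_succ_self, h, hx⟩
    · obtain ⟨t, h1, h2, h3⟩ := ih h
      exact ⟨t, h1, h2.trans n.lt_succ_self, h3⟩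

theorem exists_le_lt_of_le {f : ℕ → ℝ} {n : ℕ} {x : ℝ} {s : ℕ} (hs : f s ≤ x) (hsn : s ≤ n)
    (hx : x < f n) : ∃ t, s ≤ t ∧ t < n ∧ f t ≤ x ∧ x < f (t + 1) := by
  induction n, hsn using Nat.le_induction with
  | base => exact absurd hx hs.not_gt
  | succ n hn ih =>
    rcases le_or_gt (f n) x with h | h
    · exact ⟨n, hn, n.lt_succ_self, h, hx⟩
    · obtain ⟨t, h1, h2, h3⟩ := ih h
      exact ⟨t, h1, h2.trans n.lt_succ_self, h3⟩

/-- The neighbourhood filter in the definition is that of `EReal`; at a real point it is the image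
of the real one. -/
theorem hasBreakpointAt_iff {f : EReal → ℝ} {x : ℝ} :
    HasBreakpointAt f x ↔ ¬ ∃ a b : ℝ, ∀ᶠ y : ℝ in nhds x, f y = a + b * y := by
  unfold HasBreakpointAt
  simp only [EReal.nhds_coe, Filter.eventually_map]
  norm_cast

theorem hasBreakpointAt_trace_xi (hw : ∀ k, 0 < w k) (hpbar : pbar ∈ stdSimplex ℝ (Fin S))
    (hslopes : DistinctSlopes z w) (hD : IsSortedList z w D) {t : ℕ} (ht : t ≤ D.length)
    (hpos : 0 < (trace z w pbar D t).ξ) :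
    HasBreakpointAt (worstCase z w pbar) (trace z w pbar D t).ξ := by
  rw [hasBreakpointAt_iff]
  rintro ⟨a, b, hab⟩
  -- Iterations of length zero may precede `t`, so the affine piece ending at `ξ_t` comes from an
  -- earlier iteration `s` of positive length; `r` below plays this role on the right.
  obtain ⟨s, -, hst, hs, hs'⟩ := exists_lt_le_of_lt (f := fun t => (trace z w pbar D t).ξ)
    (s := 0) hpos t.zero_le le_rfl
  have hsD : s < D.length := hst.trans_le ht
  have hleft := slope_eq_of_affine_left (f := fun u : ℝ => worstCase z w pbar u) hs hab
    fun u hu hu' => worstCase_eq_of_mem_Icc hw hpbar hslopes hD hsD hu (hu'.trans hs')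
  -- At the last breakpoint a negative slope meets the constant piece; elsewhere two iterations of
  -- different slopes meet.
  rcases (trace_xi_mono hw hpbar hslopes hD ht le_rfl).eq_or_lt with hlast | hlast
  · have hright := slope_eq_of_affine (f := fun u : ℝ => worstCase z w pbar u)
      (c := (trace z w pbar D D.length).q) (m := 0) (lt_add_one _) hab fun u hu _ => by
        rw [zero_mul, add_zero]
        exact worstCase_eq_of_ge hw hpbar hslopes hD
          (EReal.coe_le_coe_iff.2 (hlast.symm.trans_le hu))
    exact ((hD.2.1 _).1 (List.getElem_mem hsD)).slope_neg.ne (hleft.symm.trans hright)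
  · obtain ⟨r, htr, hr, hr1, hr2⟩ := exists_le_lt_of_le
      (f := fun t => (trace z w pbar D t).ξ) le_rfl ht hlast
    have hright := slope_eq_of_affine (f := fun u : ℝ => worstCase z w pbar u) hr2 hab
      fun u hu hu' => worstCase_eq_of_mem_Icc hw hpbar hslopes hD hr (hr1.trans hu) hu'
    exact slope_ne_of_xi_lt hw hpbar hslopes hD (hst.trans_le htr) hr (hr1.trans_lt hr2)
      (hleft.symm.trans hright)

theorem exists_trace_xi_eq (hw : ∀ k, 0 < w k) (hpbar : pbar ∈ stdSimplex ℝ (Fin S))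
    (hslopes : DistinctSlopes z w) (hD : IsSortedList z w D) {x : ℝ} (hx : 0 < x)
    (hbreak : HasBreakpointAt (worstCase z w pbar) x) :
    ∃ t ≤ D.length, (trace z w pbar D t).ξ = x := by
  rw [hasBreakpointAt_iff] at hbreak
  by_contra! hne
  apply hbreak
  rcases (hne D.length le_rfl).lt_or_gt with hlast | hlast
  · refine ⟨(trace z w pbar D D.length).q, 0, ?_⟩
    filter_upwards [Ioi_mem_nhds hlast] with y hy
    rw [zero_mul, add_zero]
    exact worstCase_eq_of_ge hw hpbar hslopes hD (EReal.coe_le_coe_iff.2 (le_of_lt hy))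
  · obtain ⟨t, -, ht, h1, h2⟩ := exists_lt_le_of_lt (f := fun t => (trace z w pbar D t).ξ)
      (s := 0) hx D.length.zero_le hlast.le
    refine ⟨(trace z w pbar D t).q - D[t].slope z w * (trace z w pbar D t).ξ, D[t].slope z w, ?_⟩
    filter_upwards [Ioo_mem_nhds h1 (h2.lt_of_ne (hne (t + 1) ht).symm)] with y hy
    exact worstCase_eq_of_mem_Icc hw hpbar hslopes hD ht hy.1.le hy.2.le

theorem outXi_of_le {t : Fin (D.length + 2)} (ht : (t : ℕ) ≤ D.length) :
    outXi z w pbar D t = ((trace z w pbar D t).ξ : EReal) := if_pos ht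

theorem outXi_of_gt {t : Fin (D.length + 2)} (ht : D.length < (t : ℕ)) :
    outXi z w pbar D t = ⊤ := if_neg ht.not_ge

theorem outQ_of_le {t : Fin (D.length + 2)} (ht : (t : ℕ) ≤ D.length) :
    outQ z w pbar D t = (trace z w pbar D t).q := if_pos ht

theorem outQ_of_gt {t : Fin (D.length + 2)} (ht : D.length < (t : ℕ)) :
    outQ z w pbar D t = (trace z w pbar D D.length).q := if_neg ht.not_ge

end Output

end Homotopy

theorem mainTheorem2 {S : ℕ} (z w pbar : Fin S → ℝ) (hw : ∀ k, 0 < w k)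
    (hpbar : pbar ∈ stdSimplex ℝ (Fin S)) (hslopes : Homotopy.DistinctSlopes z w)
    (D : List (Homotopy.Entry S)) (hD : Homotopy.IsSortedList z w D) :
    -- the minimum that defines `q` is attained
    (∀ x : EReal, 0 ≤ x → IsLeast (feasibleValues z w pbar x) (worstCase z w pbar x)) ∧
    -- `0 = ξ_0 ≤ ξ_1 ≤ ⋯ ≤ ξ_T ≤ ξ_{T+1} = ∞`
    Homotopy.outXi z w pbar D 0 = 0 ∧
    Monotone (Homotopy.outXi z w pbar D) ∧
    (∀ t, Homotopy.outXi z w pbar D t = ⊤ ↔ t = Fin.last (D.length + 1)) ∧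
    -- `q` is affine on each `[ξ_t, ξ_{t+1}]`, and constant on `[ξ_T, ∞)`
    (∀ t : Fin (D.length + 1), ∃ a b : ℝ, ∀ x : ℝ,
      Homotopy.outXi z w pbar D t.castSucc ≤ x → (x : EReal) ≤ Homotopy.outXi z w pbar D t.succ →
        worstCase z w pbar x = a + b * x) ∧
    (∀ x : ℝ, Homotopy.outXi z w pbar D (Fin.last D.length).castSucc ≤ x →
      worstCase z w pbar x = Homotopy.outQ z w pbar D (Fin.last (D.length + 1))) ∧
    -- the breakpoints of `q` in `(0, ∞)` are exactly the `ξ_t` in `(0, ∞)`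
    (∀ x : ℝ, 0 < x → (HasBreakpointAt (worstCase z w pbar) x ↔
      ∃ t, Homotopy.outXi z w pbar D t = x)) ∧
    -- `q(ξ_t) = q_t` for `t = 0, …, T + 1`
    (∀ t, worstCase z w pbar (Homotopy.outXi z w pbar D t) = Homotopy.outQ z w pbar D t) := by
  have hlast : ((Fin.last (D.length + 1) : Fin (D.length + 2)) : ℕ) = D.length + 1 := rfl
  refine ⟨fun x hx => isLeast_worstCase hpbar hx, ?_, ?_, ?_, ?_, ?_, ?_, ?_⟩
  · rw [Homotopy.outXi_of_le (Nat.zero_le _)]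
    rfl
  · intro s t hst
    rcases le_or_gt (t : ℕ) D.length with ht | ht
    · have hst' : (s : ℕ) ≤ t := hst
      rw [Homotopy.outXi_of_le ht, Homotopy.outXi_of_le (hst'.trans ht)]
      exact EReal.coe_le_coe_iff.2 (Homotopy.trace_xi_mono hw hpbar hslopes hD hst' ht)
    · rw [Homotopy.outXi_of_gt ht]
      exact le_top
  · intro t
    rw [Fin.ext_iff, hlast]
    rcases le_or_gt (t : ℕ) D.length with ht | ht
    · rw [Homotopy.outXi_of_le ht]
      exact iff_of_false (EReal.coe_ne_top _) (by omega)
    · exact iff_of_true (Homotopy.outXi_of_gt ht) (by omega)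
  · intro t
    have ht' : (t.castSucc : ℕ) ≤ D.length := Nat.lt_succ_iff.1 t.isLt
    rw [Homotopy.outXi_of_le ht']
    -- The interval with index `T` ends at `⊤` and carries the constant piece; every other interval
    -- is one iteration.
    rcases (Nat.lt_succ_iff.1 t.isLt).eq_or_lt with ht | ht
    · refine ⟨(Homotopy.trace z w pbar D D.length).q, 0, fun x hx _ => ?_⟩
      rw [Fin.val_castSucc, ht] at hx
      rw [zero_mul, add_zero]
      exact Homotopy.worstCase_eq_of_ge hw hpbar hslopes hD hx
    · have ht1 : (t.succ : ℕ) ≤ D.length := ht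
      rw [Homotopy.outXi_of_le ht1]
      exact ⟨_, _, fun x hx hx' => Homotopy.worstCase_eq_of_mem_Icc hw hpbar hslopes hD ht
        (EReal.coe_le_coe_iff.1 hx) (EReal.coe_le_coe_iff.1 hx')⟩
  · intro x hx
    rw [Homotopy.outXi_of_le le_rfl] at hx
    rw [Homotopy.outQ_of_gt (Nat.lt_succ_self _)]
    exact Homotopy.worstCase_eq_of_ge hw hpbar hslopes hD hx
  · intro x hx
    constructor
    · intro hbreak
      obtain ⟨t, ht, hxt⟩ := Homotopy.exists_trace_xi_eq hw hpbar hslopes hD hx hbreak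
      refine ⟨⟨t, by omega⟩, ?_⟩
      rw [Homotopy.outXi_of_le ht, hxt]
    · rintro ⟨t, ht⟩
      rcases le_or_gt (t : ℕ) D.length with htD | htD
      · rw [Homotopy.outXi_of_le htD, EReal.coe_eq_coe_iff] at ht
        rw [← ht] at hx ⊢
        exact Homotopy.hasBreakpointAt_trace_xi hw hpbar hslopes hD htD hx
      · rw [Homotopy.outXi_of_gt htD] at ht
        exact absurd ht.symm (EReal.coe_ne_top x)
  · intro t
    rcases le_or_gt (t : ℕ) D.length with ht | ht
    · rw [Homotopy.outXi_of_le ht, Homotopy.outQ_of_le ht]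
      exact Homotopy.worstCase_trace_xi hw hpbar hslopes hD ht
    · rw [Homotopy.outXi_of_gt ht, Homotopy.outQ_of_gt ht]
      exact Homotopy.worstCase_eq_of_ge hw hpbar hslopes hD le_top
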